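/- Let $K$ be a field, $N\ge 0$ an integer, $\beta\in K$ arbitrary, and let $z_1,\dots,z_N\in K$ be such that $z_j+z_k+2\beta z_jz_k\neq 0$ for all $1\le j<k\le N$ and $1+2\beta z_k\ne 0$ for all $k$ (for example, $\beta,z_1,\dots,z_N$ may be the independent variables of the field $\mathbb{C}(\beta,z_1,\dots,z_N)$). Let $\lambda=(\lambda_1\ge\lambda_2\ge\dots\ge\lambda_N\ge 0)$ be a sequence of integers, and let $$s_\lambda(z_1,\dots,z_N)=\frac{\det\bigl(z_j^{\lambda_k+N-k}\bigr)_{1\le j,k\le N}}{\prod_{1\le j<k\le N}(z_j-z_k)}$$ be the Schur polynomial (a polynomial with integer coefficients, which may be evaluated at any point of $K^N$). Then $$s_\lambda(z_1,\dots,z_N)=\frac{1}{\prod_{1\le j<k\le N}(z_j+z_k+2\beta z_jz_k)}\sum_{x^{(N)}\succ x^{(N-1)}\succ\dots\succ x^{(0)}=\emptyset}\ \prod_{k=1}^N\Biggl\{z_k^{\sum_{j=1}^k x^{(k)}_j-\sum_{j=1}^{k-1}x^{(k-1)}_j-1}\left(\frac{2(1+\beta z_k)}{1+2\beta z_k}\right)^{\#(x^{(k)}|x^{(k-1)})-1}\prod_{j=1}^{k-1}\Bigl(1+2\beta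 z_k\bigl(1-\delta_{x^{(k-1)}_j,\,x^{(k)}_{j+1}}\bigr)\Bigr)\Biggr\}.$$ Here the sum is over all chains in which $x^{(k)}=(x^{(k)}_1>x^{(k)}_2>\dots>x^{(k)}_k\ge 1)$, $k=0,1,\dots,N$, are strict partitions with exactly $k$ parts; $x^{(N)}$ is fixed by $x^{(N)}_j=\lambda_j+N-j+1$ for $1\le j\le N$; and consecutive members interlace, where $y\succ x$ means $y_j\ge x_j\ge y_{j+1}$ for all $j$. The symbol $\#(y|x)$ denotes the number of parts of $y$ that are not parts of $x$, $\delta$ is the Kronecker delta, and $0^0=1$. -/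

import Mathlib

namespace SchurChains

open MvPolynomial

/-! ### Schur polynomials as quotients of alternants -/

/-- The alternant `det (z_j ^ (λ_k + N - k))`, with rows and columns indexed from `0`
(so that the exponent reads `λ_k + N - (k + 1)`), in the variables `z_j = X j`. -/
noncomputable def alternant {N : ℕ} (lam : Fin N → ℕ) : MvPolynomial (Fin N) ℤ :=
  (Matrix.of fun j k : Fin N =>
    (X j : MvPolynomial (Fin N) ℤ) ^ (lam k + (N - (k.val + 1)))).det

/-- The product `∏_{j < k} (z_j - z_k)`. -/
noncomputable def vandermondeProd (N : ℕ) : MvPolynomial (Fin N) ℤ :=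
  ∏ j : Fin N, ∏ k ∈ Finset.Ioi j, (X j - X k)

theorem prime_X_sub_X {N : ℕ} {a b : Fin N} (hab : a ≠ b) :
    Prime (X a - X b : MvPolynomial (Fin N) ℤ) := by
  classical
  let f : MvPolynomial (Fin N) ℤ →ₐ[ℤ] MvPolynomial (Fin N) ℤ :=
    aeval (fun i => if i = a then X a - X b else X i)
  let g : MvPolynomial (Fin N) ℤ →ₐ[ℤ] MvPolynomial (Fin N) ℤ :=
    aeval (fun i => if i = a then X a + X b else X i)
  have hfg : f.comp g = AlgHom.id ℤ _ := by
    apply MvPolynomial.algHom_ext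
    intro i
    by_cases hi : i = a
    · subst hi
      simp [f, g, hab.symm]
    · simp [f, g, hi]
  have hgf : g.comp f = AlgHom.id ℤ _ := by
    apply MvPolynomial.algHom_ext
    intro i
    by_cases hi : i = a
    · subst hi
      simp [f, g, hab.symm]
    · simp [f, g, hi]
  let e : MvPolynomial (Fin N) ℤ ≃ₐ[ℤ] MvPolynomial (Fin N) ℤ := AlgEquiv.ofAlgHom f g hfg hgf
  have he : e (X a) = X a - X b := by simp [e, f]
  rw [← he]
  exact (MulEquiv.prime_iff e.toMulEquiv).2 X_prime

theorem isRelPrime_X_sub_X {N : ℕ} {a b c d : Fin N} (hab : a < b) (hcd : c < d)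
    (hne : (a, b) ≠ (c, d)) :
    IsRelPrime (X a - X b : MvPolynomial (Fin N) ℤ) (X c - X d) := by
  classical
  rw [(prime_X_sub_X hab.ne).irreducible.isRelPrime_iff_not_dvd]
  rintro ⟨q, hq⟩
  have h := congrArg (eval (fun i : Fin N => if i = a ∨ i = b then (0 : ℤ) else i.val + 1)) hq
  simp only [map_sub, map_mul, eval_X, true_or, or_true, if_true, sub_zero, zero_mul] at h
  have hne' : ¬ (a = c ∧ b = d) := fun h => hne (by rw [h.1, h.2])
  split_ifs at h <;> grind

theorem X_sub_X_dvd_alternant {N : ℕ} (lam : Fin N → ℕ) {a b : Fin N} (hab : a ≠ b) :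
    (X a - X b : MvPolynomial (Fin N) ℤ) ∣ alternant lam := by
  rw [← Ideal.mem_span_singleton, ← Ideal.Quotient.eq_zero_iff_mem, alternant, RingHom.map_det]
  apply Matrix.det_zero_of_row_eq hab
  have h : Ideal.Quotient.mk (Ideal.span {(X a - X b : MvPolynomial (Fin N) ℤ)}) (X a) =
      Ideal.Quotient.mk _ (X b) :=
    Ideal.Quotient.eq.2 (Ideal.mem_span_singleton_self _)
  ext k
  simp [h]

theorem vandermondeProd_dvd_alternant {N : ℕ} (lam : Fin N → ℕ) :
    vandermondeProd N ∣ alternant lam := by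
  rw [vandermondeProd, Finset.prod_sigma']
  apply Finset.prod_dvd_of_isRelPrime
  · rintro ⟨a, b⟩ hab ⟨c, d⟩ hcd hne
    simp only [Finset.coe_sigma, Set.mem_sigma_iff, Finset.mem_coe, Finset.mem_Ioi,
      Finset.mem_univ, true_and] at hab hcd
    refine isRelPrime_X_sub_X hab hcd ?_
    intro h
    apply hne
    simp only [Prod.mk.injEq] at h
    rw [h.1, h.2]
  · rintro ⟨a, b⟩ hab
    simp only [Finset.mem_sigma, Finset.mem_Ioi, Finset.mem_univ, true_and] at hab
    exact X_sub_X_dvd_alternant lam hab.ne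

/-- The Schur polynomial `s_λ = det (z_j ^ (λ_k + N - k)) / ∏_{j < k} (z_j - z_k)`, as a
polynomial with integer coefficients: the quotient of the alternant by the Vandermonde product. -/
noncomputable def schurPolynomial {N : ℕ} (lam : Fin N → ℕ) : MvPolynomial (Fin N) ℤ :=
  Classical.choose (vandermondeProd_dvd_alternant lam)

/-- The defining property of the Schur polynomial; it determines the Schur polynomial, as
`MvPolynomial (Fin N) ℤ` is a domain in which the Vandermonde product is nonzero. -/
theorem vandermondeProd_mul_schurPolynomial {N : ℕ} (lam : Fin N → ℕ) :
    vandermondeProd N * schurPolynomial lam = alternant lam :=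
  (Classical.choose_spec (vandermondeProd_dvd_alternant lam)).symm

theorem vandermondeProd_ne_zero (N : ℕ) : vandermondeProd N ≠ 0 := by
  simp only [vandermondeProd, Finset.prod_ne_zero_iff, Finset.mem_Ioi]
  exact fun a _ b hab => (prime_X_sub_X hab.ne).ne_zero

/-! ### Interlacing chains of strict partitions -/

/-- `x = (x_1 > x_2 > … > x_k > 0)`. -/
def IsStrictPartition {k : ℕ} (x : Fin k → ℕ) : Prop :=
  StrictAnti x ∧ ∀ j, 0 < x j

/-- `y ≻ x`: `y_j ≥ x_j ≥ y_{j+1}` for `j = 1, …, k`. -/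
def Interlaces {k : ℕ} (y : Fin (k + 1) → ℕ) (x : Fin k → ℕ) : Prop :=
  ∀ j : Fin k, x j ≤ y j.castSucc ∧ y j.succ ≤ x j

/-- `#(y|x)`: the number of parts of `y` which are not parts of `x`. -/
def numNewParts {l k : ℕ} (y : Fin l → ℕ) (x : Fin k → ℕ) : ℕ :=
  (Finset.univ.filter fun j : Fin l => ∀ i : Fin k, x i ≠ y j).card

/-- The chains `y = x^(N) ≻ x^(N-1) ≻ … ≻ x^(0) = ∅` of interlacing strict partitions, where
`x^(k)` has `k` parts (so that `x^(0)` is the empty partition). -/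
def chainSet {N : ℕ} (y : Fin N → ℕ) : Set ((k : Fin (N + 1)) → Fin k.val → ℕ) :=
  {x | (∀ k : Fin (N + 1), IsStrictPartition (x k)) ∧
    (∀ k : Fin N, Interlaces (k := k.val) (x k.succ) (x k.castSucc)) ∧
    x (Fin.last N) = y}

theorem chainSet_finite {N : ℕ} (y : Fin N → ℕ) : (chainSet y).Finite := by
  apply (Set.finite_Icc (0 : (k : Fin (N + 1)) → Fin k.val → ℕ) (fun _ _ => ∑ i, y i)).subset
  rintro x ⟨-, hint, hlast⟩
  refine ⟨fun _ _ => Nat.zero_le _, ?_⟩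
  intro k
  induction k using Fin.reverseInduction with
  | last =>
    rw [hlast]
    exact fun j => Finset.single_le_sum (f := y) (fun _ _ => Nat.zero_le _) (Finset.mem_univ j)
  | cast k ih =>
    intro j
    exact (hint k j).1.trans (ih (Fin.castSucc (n := k.val) j))

/-- The finite set of all chains of interlacing strict partitions with top element `y`. -/
noncomputable def chains {N : ℕ} (y : Fin N → ℕ) :
    Finset ((k : Fin (N + 1)) → Fin k.val → ℕ) :=
  (chainSet_finite y).toFinset

/-- The shift `x_j = λ_j + N - j + 1` of `λ` (`j` counted from `1`), that is `λ_j + (N - j)` with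
`j` counted from `0`. -/
def shifted {N : ℕ} (lam : Fin N → ℕ) : Fin N → ℕ := fun j => lam j + (N - j.val)

/-- The factor that the step `y ≻ x` contributes, with spectral variable `z`:
`z ^ (∑ y_j - ∑ x_j - 1) * (2 (1 + β z) / (1 + 2 β z)) ^ (#(y|x) - 1)
  * ∏_j (1 + 2 β z (1 - δ_{x_j, y_{j+1}}))`.  The exponents are integers. -/
noncomputable def stepWeight {K : Type*} [Field K] (β z : K) {k : ℕ}
    (y : Fin (k + 1) → ℕ) (x : Fin k → ℕ) : K :=
  z ^ ((∑ j, (y j : ℤ)) - (∑ j, (x j : ℤ)) - 1) *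
    (2 * (1 + β * z) / (1 + 2 * β * z)) ^ ((numNewParts y x : ℤ) - 1) *
    ∏ j : Fin k, (1 + 2 * β * z * (1 - if x j = y j.succ then 1 else 0))

end SchurChains

namespace SchurChains

open MvPolynomial

/-! ### The determinantal identity -/

section Determinant

variable {R : Type*} [CommRing R]

/-! The Vandermonde product times the chain sum equals ∏(z_j + z_k + 2βz_jz_k) times the alternant,
by induction on N, peeling off the top step y ≻ x with variable z. After clearing denominators
(`stepWeight_eq_stepPoly`) its weight is a product of factors, one per part x_j, so multilinearity
turns the sum of weighted alternants over x into a determinant of one-variable sums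
(`sum_stepPoly_mul_det`). Each is nearly geometric: multiplied by u - z it becomes (u + z +
2βuz)(u^(a-1) - z^(a-b)u^(b-1)), as in `sub_mul_sum_partCoeff`. The two-term entries on the right
are what column operations leave of the larger alternant once z's row is eliminated
(`det_pow_eq_mul_det`). Since the z_j may coincide, the Vandermonde product is cancelled for
independent variables, before specialization. -/

/-- The coefficient with which a part `x` between `b` and `a` contributes to a step. -/
def partCoeff (β z : R) (a b x : ℕ) : R :=
  if x = b then 1 else if x = a then 1 + 2 * β * z else 2 * (1 + β * z)

/-- The weight of a step in a form without denominators. -/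
def stepPoly (β z : R) {k : ℕ} (y : Fin (k + 1) → ℕ) (x : Fin k → ℕ) : R :=
  z ^ (y (Fin.last k) - 1) *
    ∏ j : Fin k, partCoeff β z (y j.castSucc) (y j.succ) (x j) * z ^ (y j.castSucc - x j)

theorem sub_mul_sum_Ico (u z : R) {a b : ℕ} (hab : b + 1 ≤ a) :
    (u - z) * ∑ x ∈ Finset.Ico (b + 1) a, z ^ (a - x) * u ^ (x - 1) =
      z * u ^ (a - 1) - z ^ (a - b) * u ^ b := by
  induction a, hab using Nat.le_induction with
  | base => simp
  | succ a hab ih =>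
    obtain ⟨d, rfl⟩ := Nat.exists_eq_add_of_le hab
    rw [Finset.sum_Ico_succ_top hab]
    have h : ∑ x ∈ Finset.Ico (b + 1) (b + 1 + d), z ^ (b + 1 + d + 1 - x) * u ^ (x - 1) =
        z * ∑ x ∈ Finset.Ico (b + 1) (b + 1 + d), z ^ (b + 1 + d - x) * u ^ (x - 1) := by
      rw [Finset.mul_sum]
      refine Finset.sum_congr rfl fun x hx => ?_
      rw [Finset.mem_Ico] at hx
      rw [show b + 1 + d + 1 - x = b + 1 + d - x + 1 by omega]
      ring
    rw [h, mul_add, mul_left_comm, ih]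
    simp only [show b + 1 + d - 1 = b + d by omega, show b + 1 + d - b = d + 1 by omega,
      show b + 1 + d + 1 - b = d + 2 by omega, show b + 1 + d + 1 - (b + 1 + d) = 1 by omega,
      show b + 1 + d + 1 - 1 = b + d + 1 by omega]
    ring

theorem sub_mul_sum_partCoeff (β u z : R) {a b : ℕ} (hb : 0 < b) (hab : b < a) :
    (u - z) * ∑ x ∈ Finset.Icc b a, partCoeff β z a b x * z ^ (a - x) * u ^ (x - 1) =
      (u + z + 2 * β * u * z) * (u ^ (a - 1) - z ^ (a - b) * u ^ (b - 1)) := by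
  -- Only the endpoints carry exceptional coefficients; the interior is a plain geometric sum.
  have h : ∑ x ∈ Finset.Icc b a, partCoeff β z a b x * z ^ (a - x) * u ^ (x - 1) =
      z ^ (a - b) * u ^ (b - 1) + (1 + 2 * β * z) * u ^ (a - 1) +
        2 * (1 + β * z) * ∑ x ∈ Finset.Ico (b + 1) a, z ^ (a - x) * u ^ (x - 1) := by
    rw [← Finset.Ico_add_one_right_eq_Icc, Finset.sum_Ico_succ_top hab.le,
      Finset.sum_eq_sum_Ico_succ_bot hab, Finset.mul_sum]
    have : ∀ x ∈ Finset.Ico (b + 1) a, partCoeff β z a b x * z ^ (a - x) * u ^ (x - 1) =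
        2 * (1 + β * z) * (z ^ (a - x) * u ^ (x - 1)) := by
      intro x hx
      rw [Finset.mem_Ico] at hx
      rw [partCoeff, if_neg (by omega), if_neg (by omega), mul_assoc]
    rw [Finset.sum_congr rfl this]
    simp only [partCoeff, if_true, if_neg hab.ne', Nat.sub_self, pow_zero]
    ring
  rw [h, mul_add, mul_left_comm, sub_mul_sum_Ico u z hab]
  obtain ⟨c, rfl⟩ := Nat.exists_eq_add_of_lt hb
  simp only [zero_add, Nat.add_sub_cancel]
  ring

/-- Eliminating the last row of a generalized Vandermonde determinant by column operations. -/
theorem det_pow_eq_mul_det {k : ℕ} (v : Fin (k + 1) → R) (e : Fin (k + 1) → ℕ)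
    (he : ∀ j : Fin k, e j.succ ≤ e j.castSucc) :
    (Matrix.of fun i j => v i ^ e j).det =
      v (Fin.last k) ^ e (Fin.last k) *
        (Matrix.of fun i j : Fin k => v i.castSucc ^ e j.castSucc -
          v (Fin.last k) ^ (e j.castSucc - e j.succ) * v i.castSucc ^ e j.succ).det := by
  set z := v (Fin.last k) with hz
  let B : Matrix (Fin (k + 1)) (Fin (k + 1)) R := Matrix.of fun i =>
    Fin.snoc (α := fun _ => R)
      (fun j => v i ^ e j.castSucc - z ^ (e j.castSucc - e j.succ) * v i ^ e j.succ)
      (v i ^ e (Fin.last k))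
  have h1 : (Matrix.of fun i j => v i ^ e j).det = B.det := by
    -- Column j is corrected by column j + 1, whereas the Mathlib lemma uses the preceding column;
    -- hence the reversal.
    rw [← Matrix.det_submatrix_equiv_self Fin.revPerm, ← Matrix.det_submatrix_equiv_self
      Fin.revPerm B]
    refine Matrix.det_eq_of_forall_col_eq_smul_add_pred
      (fun j => z ^ (e j.rev.castSucc - e j.rev.succ)) (fun i => ?_) fun i j => ?_
    · simp [B]
    · simp [B, Fin.rev_succ, Fin.rev_castSucc]
  have h2 : ∀ j : Fin k, B (Fin.last k) j.castSucc = 0 := by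
    intro j
    simp only [B, Matrix.of_apply, Fin.snoc_castSucc, ← hz, ← pow_add]
    rw [Nat.sub_add_cancel (he j), sub_self]
  rw [h1, Matrix.det_succ_row B (Fin.last k), Fin.sum_univ_castSucc]
  simp only [h2, mul_zero, zero_mul, Finset.sum_const_zero, zero_add, Fin.val_last,
    Even.neg_pow ⟨k, rfl⟩, one_pow, one_mul]
  congr 1
  · simp [B, hz]
  · congr 1
    ext i j
    simp [B]

/-- The interlacing strict partitions below `y`. -/
noncomputable def predecessors {k : ℕ} (y : Fin (k + 1) → ℕ) : Finset (Fin k → ℕ) :=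
  open Classical in
  (Fintype.piFinset fun j : Fin k => Finset.Icc (y j.succ) (y j.castSucc)).filter StrictAnti

theorem mem_predecessors {k : ℕ} {y : Fin (k + 1) → ℕ} (hy : IsStrictPartition y)
    {x : Fin k → ℕ} : x ∈ predecessors y ↔ IsStrictPartition x ∧ Interlaces y x := by
  simp only [predecessors, Finset.mem_filter, Fintype.mem_piFinset, Finset.mem_Icc,
    IsStrictPartition, Interlaces]
  constructor
  · rintro ⟨h, hs⟩
    exact ⟨⟨hs, fun j => (hy.2 j.succ).trans_le (h j).1⟩, fun j => ⟨(h j).2, (h j).1⟩⟩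
  · rintro ⟨⟨hs, -⟩, h⟩
    exact ⟨fun j => ⟨(h j).2, (h j).1⟩, hs⟩

/-- The box conditions give x_i ≥ y_{i+1} ≥ x_{i+1}, so strictness can fail only through two equal
neighbours, which give equal rows. -/
theorem det_pow_eq_zero {k : ℕ} (u : Fin k → R) {y : Fin (k + 1) → ℕ} {x : Fin k → ℕ}
    (hx : ∀ j, x j ∈ Finset.Icc (y j.succ) (y j.castSucc)) (hs : ¬ StrictAnti x) :
    (Matrix.of fun j i => u i ^ (x j - 1)).det = 0 := by
  cases k with
  | zero => exact absurd (fun i => i.elim0) hs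
  | succ k =>
    rw [Fin.strictAnti_iff_succ_lt] at hs
    push Not at hs
    obtain ⟨i, hi⟩ := hs
    have h1 := Finset.mem_Icc.1 (hx i.castSucc)
    have h2 := Finset.mem_Icc.1 (hx i.succ)
    rw [← Fin.succ_castSucc] at h2
    have h : x i.castSucc = x i.succ := le_antisymm hi (h2.2.trans h1.1)
    refine Matrix.det_zero_of_row_eq (Fin.castSucc_lt_succ (i := i)).ne ?_
    ext l
    simp [h]

/-- Expanding the right side by multilinearity gives a sum over the whole box of intermediate x; the
non-strict x contribute zero. -/
theorem sum_stepPoly_mul_det (β z : R) {k : ℕ} (u : Fin k → R) (y : Fin (k + 1) → ℕ) :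
    ∑ x ∈ predecessors y, stepPoly β z y x * (Matrix.of fun i j => u i ^ (x j - 1)).det =
      z ^ (y (Fin.last k) - 1) * (Matrix.of fun i j : Fin k =>
        ∑ x ∈ Finset.Icc (y j.succ) (y j.castSucc),
          partCoeff β z (y j.castSucc) (y j.succ) x * z ^ (y j.castSucc - x) *
            u i ^ (x - 1)).det := by
  classical
  have hT : ∀ x : Fin k → ℕ, (Matrix.of fun i j => u i ^ (x j - 1)).det =
      (Matrix.of fun j i => u i ^ (x j - 1)).det := fun x => (Matrix.det_transpose _).symm
  simp only [hT]
  rw [predecessors, Finset.sum_filter_of_ne]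
  swap
  · intro x hx hne
    by_contra hs
    exact hne (by rw [det_pow_eq_zero u (Fintype.mem_piFinset.1 hx) hs, mul_zero])
  rw [← Matrix.det_transpose (Matrix.of fun i j : Fin k => Finset.sum _ _)]
  have := (Matrix.detRowAlternating (n := Fin k) (R := R)).toMultilinearMap.map_sum_finset
    (fun (j : Fin k) (x : ℕ) (i : Fin k) =>
      partCoeff β z (y j.castSucc) (y j.succ) x * z ^ (y j.castSucc - x) * u i ^ (x - 1))
    (fun j => Finset.Icc (y j.succ) (y j.castSucc))
  have h2 : (Matrix.of fun i j : Fin k => ∑ x ∈ Finset.Icc (y j.succ) (y j.castSucc),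
      partCoeff β z (y j.castSucc) (y j.succ) x * z ^ (y j.castSucc - x) *
        u i ^ (x - 1)).transpose = fun j => ∑ x ∈ Finset.Icc (y j.succ) (y j.castSucc),
      fun i => partCoeff β z (y j.castSucc) (y j.succ) x * z ^ (y j.castSucc - x) *
        u i ^ (x - 1) := by
    ext j i
    simp [Finset.sum_apply]
  rw [h2]
  refine Eq.trans ?_ (congrArg _ this.symm)
  rw [Finset.mul_sum]
  refine Finset.sum_congr rfl fun x _ => ?_
  rw [stepPoly, mul_assoc]
  congr 1
  exact (Matrix.det_mul_column _ (Matrix.of fun j i => u i ^ (x j - 1))).symm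

/-- Absorbing each product into the rows of a determinant reduces the claim to the one-variable
identity, entry by entry. -/
theorem prod_sub_mul_sum_stepPoly (β : R) {k : ℕ} (v : Fin (k + 1) → R) {y : Fin (k + 1) → ℕ}
    (hy : IsStrictPartition y) :
    (∏ i : Fin k, (v i.castSucc - v (Fin.last k))) *
        ∑ x ∈ predecessors y, stepPoly β (v (Fin.last k)) y x *
          (Matrix.of fun i j : Fin k => v i.castSucc ^ (x j - 1)).det =
      (∏ i : Fin k, (v i.castSucc + v (Fin.last k) + 2 * β * v i.castSucc * v (Fin.last k))) *
        (Matrix.of fun i j => v i ^ (y j - 1)).det := by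
  have hlt : ∀ j : Fin k, y j.succ < y j.castSucc := fun j => hy.1 Fin.castSucc_lt_succ
  rw [sum_stepPoly_mul_det β _ fun i : Fin k => v i.castSucc,
    det_pow_eq_mul_det v (fun j => y j - 1) fun j => Nat.sub_le_sub_right (hlt j).le 1,
    mul_left_comm, ← Matrix.det_mul_column, mul_left_comm, ← Matrix.det_mul_column]
  congr 2
  ext i j
  simp only [Matrix.of_apply]
  rw [sub_mul_sum_partCoeff β _ _ (hy.2 _) (hlt j),
    show y j.castSucc - 1 - (y j.succ - 1) = y j.castSucc - y j.succ by have := hy.2 j.succ; omega]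

end Determinant

/-! ### Sums over chains -/

theorem mem_chains {N : ℕ} {y : Fin N → ℕ} {x : (k : Fin (N + 1)) → Fin k.val → ℕ} :
    x ∈ chains y ↔ (∀ k : Fin (N + 1), IsStrictPartition (x k)) ∧
      (∀ k : Fin N, Interlaces (k := k.val) (x k.succ) (x k.castSucc)) ∧
      x (Fin.last N) = y := by
  simp [chains, chainSet]

theorem sum_chains_zero {M : Type*} [CommSemiring M] (y : Fin 0 → ℕ)
    (w : (k : Fin 0) → (Fin (k.val + 1) → ℕ) → (Fin k.val → ℕ) → M) :
    ∑ x ∈ chains y, ∏ k : Fin 0, w k (x k.succ) (x k.castSucc) = 1 := by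
  have h : chains y = {fun k j => (Fin.cast (Nat.lt_one_iff.1 k.2) j).elim0} := by
    ext x
    rw [mem_chains, Finset.mem_singleton]
    constructor
    · intro _
      funext k j
      exact (Fin.cast (Nat.lt_one_iff.1 k.2) j).elim0
    · rintro rfl
      refine ⟨fun k => ⟨fun j => (Fin.cast (Nat.lt_one_iff.1 k.2) j).elim0,
        fun j => (Fin.cast (Nat.lt_one_iff.1 k.2) j).elim0⟩, fun k => k.elim0, ?_⟩
      funext j
      exact j.elim0
  simp [h]

theorem sum_chains_succ {M : Type*} [CommSemiring M] {N : ℕ} {y : Fin (N + 1) → ℕ}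
    (hy : IsStrictPartition y)
    (w : (k : Fin (N + 1)) → (Fin (k.val + 1) → ℕ) → (Fin k.val → ℕ) → M) :
    ∑ x ∈ chains y, ∏ k : Fin (N + 1), w k (x k.succ) (x k.castSucc) =
      ∑ x' ∈ predecessors y, w (Fin.last N) y x' *
        ∑ x ∈ chains x', ∏ k : Fin N, w k.castSucc (x k.succ) (x k.castSucc) := by
  simp only [Finset.mul_sum]
  rw [Finset.sum_sigma']
  symm
  refine Finset.sum_bij'
    (fun p _ => Fin.snoc (α := fun k : Fin (N + 2) => Fin k.val → ℕ) p.2 y)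
    (fun x _ => ⟨x (Fin.last N).castSucc, fun k => x k.castSucc⟩) ?_ ?_ ?_ ?_ ?_
  · rintro ⟨x', x⟩ h
    rw [Finset.mem_sigma, mem_predecessors hy, mem_chains] at h
    dsimp only at h
    obtain ⟨⟨hx', hint'⟩, hx, hint, rfl⟩ := h
    rw [mem_chains]
    refine ⟨fun k => ?_, fun k => ?_, by simp⟩
    · induction k using Fin.lastCases with
      | last => simpa using hy
      | cast k => simpa using hx k
    · induction k using Fin.lastCases with
      | last => simpa using hint'
      | cast k =>
        have h := hint k
        -- Once both members are read as entries of the extended chain, `k.succ.castSucc` and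
        -- `k.castSucc.succ` agree definitionally.
        rw [← Fin.snoc_castSucc (α := fun k : Fin (N + 2) => Fin k.val → ℕ) y x k.succ,
          ← Fin.snoc_castSucc (α := fun k : Fin (N + 2) => Fin k.val → ℕ) y x k.castSucc] at h
        exact h
  · intro x h
    rw [mem_chains] at h
    obtain ⟨hx, hint, rfl⟩ := h
    rw [Finset.mem_sigma, mem_predecessors hy, mem_chains]
    exact ⟨⟨hx _, hint (Fin.last N)⟩, fun k => hx _, fun k => hint k.castSucc, rfl⟩
  · rintro ⟨x', x⟩ h
    rw [Finset.mem_sigma, mem_chains] at h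
    dsimp only at h
    obtain ⟨-, -, -, rfl⟩ := h
    simp
  · intro x h
    rw [mem_chains] at h
    obtain ⟨hx, hint, rfl⟩ := h
    funext k
    induction k using Fin.lastCases with
    | last => simp
    | cast k => simp
  · rintro ⟨x', x⟩ h
    rw [Finset.mem_sigma, mem_chains] at h
    dsimp only at h
    obtain ⟨-, -, -, rfl⟩ := h
    rw [Fin.prod_univ_castSucc, mul_comm]
    congr 1
    · refine Finset.prod_congr rfl fun k _ => ?_
      dsimp only
      rw [← Fin.snoc_castSucc (α := fun k : Fin (N + 2) => Fin k.val → ℕ) y x k.succ,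
        ← Fin.snoc_castSucc (α := fun k : Fin (N + 2) => Fin k.val → ℕ) y x k.castSucc]
      rfl
    · simp

theorem prod_prod_Ioi_castSucc {M : Type*} [CommMonoid M] {N : ℕ}
    (f : Fin (N + 1) → Fin (N + 1) → M) :
    ∏ j, ∏ k ∈ Finset.Ioi j, f j k =
      (∏ j : Fin N, ∏ k ∈ Finset.Ioi j, f j.castSucc k.castSucc) *
        ∏ j : Fin N, f j.castSucc (Fin.last N) := by
  have h : ∀ (n : ℕ) (j : Fin n) (g : Fin n → M),
      ∏ k ∈ Finset.Ioi j, g k = ∏ k, if j < k then g k else 1 := by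
    intro n j g
    rw [← Finset.prod_filter, Finset.filter_lt_eq_Ioi]
  simp only [h, Fin.prod_univ_castSucc, Finset.prod_mul_distrib]
  simp [Fin.castSucc_lt_last, (Fin.castSucc_lt_last _).not_gt]

theorem vandermonde_mul_sum_chains {R : Type*} [CommRing R] (β : R) {N : ℕ} (v : Fin N → R)
    {y : Fin N → ℕ} (hy : IsStrictPartition y) :
    (∏ j, ∏ k ∈ Finset.Ioi j, (v j - v k)) *
        ∑ x ∈ chains y, ∏ k : Fin N, stepPoly (k := k.val) β (v k) (x k.succ) (x k.castSucc) =
      (∏ j, ∏ k ∈ Finset.Ioi j, (v j + v k + 2 * β * v j * v k)) *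
        (Matrix.of fun i j => v i ^ (y j - 1)).det := by
  induction N with
  | zero =>
    rw [sum_chains_zero y fun k => stepPoly (k := k.val) β (v k)]
    simp
  | succ N ih =>
    rw [sum_chains_succ hy fun k => stepPoly (k := k.val) β (v k), prod_prod_Ioi_castSucc,
      prod_prod_Ioi_castSucc, mul_assoc, mul_assoc, ← prod_sub_mul_sum_stepPoly β v hy,
      mul_left_comm, mul_left_comm (∏ j, ∏ k ∈ _, _)]
    congr 1
    -- The smaller Vandermonde product enters the sum, so that the induction hypothesis applies to
    -- each x separately.
    rw [Finset.mul_sum, Finset.mul_sum]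
    refine Finset.sum_congr rfl fun x hx => ?_
    rw [mul_left_comm, mul_left_comm (∏ j, ∏ k ∈ _, _),
      ← ih (fun i => v i.castSucc) ((mem_predecessors hy).1 hx).1]

/-! ### Comparison with the weights of the steps -/

/-- Interlacing confines x_i to [y_{i+1}, y_i], which contains no other part of the strictly
decreasing y. -/
theorem exists_eq_iff {k : ℕ} {y : Fin (k + 1) → ℕ} {x : Fin k → ℕ} (hy : StrictAnti y)
    (h : Interlaces y x) (i : Fin k) :
    (∃ j, x i = y j) ↔ x i = y i.succ ∨ x i = y i.castSucc := by
  constructor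
  · rintro ⟨j, hj⟩
    have h1 : y j ≤ y i.castSucc := hj ▸ (h i).1
    have h2 : y i.succ ≤ y j := hj ▸ (h i).2
    rw [hy.le_iff_ge] at h1 h2
    rw [Fin.le_def] at h1 h2
    simp only [Fin.val_castSucc, Fin.val_succ] at h1 h2
    rcases (show j.val = i.val ∨ j.val = i.val + 1 by omega) with h3 | h3
    · right; rw [hj]; congr 1; exact Fin.ext h3
    · left; rw [hj]; congr 1; exact Fin.ext h3
  · rintro (h | h) <;> exact ⟨_, h⟩

/-- The common parts can be counted in y or in x, and y has one part more; this explains the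
exponent #(y|x) - 1. -/
theorem numNewParts_eq {k : ℕ} {y : Fin (k + 1) → ℕ} {x : Fin k → ℕ} (hy : StrictAnti y)
    (hx : StrictAnti x) (h : Interlaces y x) :
    numNewParts y x =
      (Finset.univ.filter fun j : Fin k => ¬ (x j = y j.succ ∨ x j = y j.castSucc)).card + 1 := by
  classical
  have h1 := Finset.card_filter_add_card_filter_not (s := (Finset.univ : Finset (Fin (k + 1))))
    fun j => ∀ i : Fin k, x i ≠ y j
  have h2 := Finset.card_filter_add_card_filter_not (s := (Finset.univ : Finset (Fin k)))
    fun j => x j = y j.succ ∨ x j = y j.castSucc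
  have h3 : (Finset.univ.filter fun j : Fin (k + 1) => ¬ ∀ i : Fin k, x i ≠ y j).image y =
      (Finset.univ.filter fun j : Fin k => x j = y j.succ ∨ x j = y j.castSucc).image x := by
    ext m
    simp only [Finset.mem_image, Finset.mem_filter, Finset.mem_univ, true_and,
      ← exists_eq_iff hy h]
    push Not
    constructor
    · rintro ⟨j, ⟨i, hi⟩, rfl⟩
      exact ⟨i, ⟨j, hi⟩, hi⟩
    · rintro ⟨i, ⟨j, hj⟩, rfl⟩
      exact ⟨j, ⟨i, hj⟩, hj.symm⟩
  have h4 := congrArg Finset.card h3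
  rw [Finset.card_image_of_injective _ hy.injective,
    Finset.card_image_of_injective _ hx.injective] at h4
  rw [Finset.card_univ, Fintype.card_fin] at h1 h2
  rw [numNewParts]
  omega

/-- Each part of x that is not a part of y supplies one fraction 2(1+βz)/(1+2βz), whose denominator
cancels against its factor 1+2βz. Both integer exponents are natural numbers here, so z = 0 needs no
separate treatment. -/
theorem stepWeight_eq_stepPoly {K : Type*} [Field K] {β z : K} (hz : 1 + 2 * β * z ≠ 0) {k : ℕ}
    {y : Fin (k + 1) → ℕ} {x : Fin k → ℕ} (hy : IsStrictPartition y) (hx : StrictAnti x)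
    (h : Interlaces y x) : stepWeight β z y x = stepPoly β z y x := by
  classical
  have hexp : (∑ j, (y j : ℤ)) - (∑ j, (x j : ℤ)) - 1 =
      ((y (Fin.last k) - 1 + ∑ j : Fin k, (y j.castSucc - x j) : ℕ) : ℤ) := by
    rw [Fin.sum_univ_castSucc, Nat.cast_add, Nat.cast_sub (hy.2 _), Nat.cast_sum,
      Finset.sum_congr rfl fun j _ => Nat.cast_sub (h j).1, Finset.sum_sub_distrib]
    push_cast
    ring
  rw [stepWeight, stepPoly, hexp, zpow_natCast, numNewParts_eq hy.1 hx h, Nat.cast_add,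
    Nat.cast_one, add_sub_cancel_right, zpow_natCast, Finset.card_filter,
    ← Finset.prod_pow_eq_pow_sum, pow_add, mul_assoc, mul_assoc, ← Finset.prod_pow_eq_pow_sum,
    ← Finset.prod_mul_distrib, ← Finset.prod_mul_distrib]
  congr 1
  refine Finset.prod_congr rfl fun j _ => ?_
  rw [mul_comm]
  congr 1
  have hne : y j.castSucc ≠ y j.succ := (hy.1 Fin.castSucc_lt_succ).ne'
  rw [partCoeff]
  by_cases h1 : x j = y j.succ
  · simp [h1]
  · by_cases h2 : x j = y j.castSucc
    · simp [h2, hne]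
    · simp [h1, h2, div_mul_cancel₀ _ hz]

theorem map_stepPoly {R S : Type*} [CommRing R] [CommRing S] (φ : R →+* S) (β z : R) {k : ℕ}
    (y : Fin (k + 1) → ℕ) (x : Fin k → ℕ) :
    φ (stepPoly β z y x) = stepPoly (φ β) (φ z) y x := by
  have h2 : φ 2 = 2 := map_ofNat φ 2
  simp [stepPoly, partCoeff, map_prod, apply_ite φ, h2]

theorem isStrictPartition_shifted {N : ℕ} {lam : Fin N → ℕ} (hlam : Antitone lam) :
    IsStrictPartition (shifted lam) := by
  constructor
  · intro i j hij
    have h1 := hlam hij.le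
    have h2 := j.2
    rw [Fin.lt_def] at hij
    simp only [shifted]
    omega
  · intro j
    have h2 := j.2
    simp only [shifted]
    omega

/-! ### Schur polynomials and specialization of the variables -/

theorem vandermonde_mul_aeval_schurPolynomial {R : Type*} [CommRing R] {N : ℕ} (v : Fin N → R)
    (lam : Fin N → ℕ) :
    (∏ j, ∏ k ∈ Finset.Ioi j, (v j - v k)) * aeval v (schurPolynomial lam) =
      (Matrix.of fun i j => v i ^ (shifted lam j - 1)).det := by
  have h := congrArg (aeval v) (vandermondeProd_mul_schurPolynomial lam)
  rw [map_mul] at h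
  simp only [vandermondeProd, map_prod, map_sub, aeval_X] at h
  rw [h, alternant, AlgHom.map_det]
  congr 1
  ext i j
  have : lam j + (N - (j.val + 1)) = shifted lam j - 1 := by
    have := j.2
    simp only [shifted]
    omega
  simp [this]

theorem map_aeval_int {σ R S : Type*} [CommRing R] [CommRing S] (φ : R →+* S) (v : σ → R)
    (p : MvPolynomial σ ℤ) : φ (aeval v p) = aeval (φ ∘ v) p := by
  rw [aeval_def, aeval_def, hom_eval₂]
  congr 1
  exact RingHom.ext_int _ _

theorem sum_chains_eq_mul_schurPolynomial {K : Type*} [Field K] {N : ℕ} (β : K) (z : Fin N → K)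
    {lam : Fin N → ℕ} (hlam : Antitone lam) :
    ∑ x ∈ chains (shifted lam),
        ∏ k : Fin N, stepPoly (k := k.val) β (z k) (x k.succ) (x k.castSucc) =
      (∏ j, ∏ k ∈ Finset.Ioi j, (z j + z k + 2 * β * z j * z k)) *
        aeval z (schurPolynomial lam) := by
  -- The generic point `X` makes the Vandermonde product nonzero; evaluation at `z` follows the
  -- cancellation.
  have h := vandermonde_mul_sum_chains (C β : MvPolynomial (Fin N) K) X
    (isStrictPartition_shifted hlam)
  rw [← vandermonde_mul_aeval_schurPolynomial, mul_left_comm] at h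
  have hV : (∏ j, ∏ k ∈ Finset.Ioi j, (X j - X k : MvPolynomial (Fin N) K)) ≠ 0 := by
    simp only [Finset.prod_ne_zero_iff, Finset.mem_Ioi, sub_ne_zero]
    intro a _ b hab
    exact (X_injective (R := K)).ne hab.ne
  have h' := congrArg (eval z) (mul_left_cancel₀ hV h)
  rw [map_mul, map_aeval_int] at h'
  simpa only [map_sum, map_prod, map_mul, map_add, map_ofNat, map_stepPoly, eval_C, eval_X,
    Function.comp_def]
    using h'

end SchurChains

theorem mainTheorem1 {K : Type*} [Field K] (N : ℕ) (β : K) (z : Fin N → K)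
    (lam : Fin N → ℕ) (hlam : Antitone lam)
    (hden : ∀ j k : Fin N, j < k → z j + z k + 2 * β * z j * z k ≠ 0)
    (hden' : ∀ k : Fin N, 1 + 2 * β * z k ≠ 0) :
    MvPolynomial.aeval z (SchurChains.schurPolynomial lam) =
      1 / (∏ j : Fin N, ∏ k ∈ Finset.Ioi j, (z j + z k + 2 * β * z j * z k)) *
        ∑ x ∈ SchurChains.chains (SchurChains.shifted lam),
          ∏ k : Fin N,
            SchurChains.stepWeight (k := k.val) β (z k) (x k.succ) (x k.castSucc) := by

  have hP : (∏ j : Fin N, ∏ k ∈ Finset.Ioi j, (z j + z k + 2 * β * z j * z k)) ≠ 0 := by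
    simp only [Finset.prod_ne_zero_iff, Finset.mem_Ioi]
    exact fun j _ k hjk => hden j k hjk
  have h : ∀ x ∈ SchurChains.chains (SchurChains.shifted lam), ∏ k : Fin N,
      SchurChains.stepWeight (k := k.val) β (z k) (x k.succ) (x k.castSucc) =
      ∏ k : Fin N, SchurChains.stepPoly (k := k.val) β (z k) (x k.succ) (x k.castSucc) := by
    intro x hx
    rw [SchurChains.mem_chains] at hx
    exact Finset.prod_congr rfl fun k _ => SchurChains.stepWeight_eq_stepPoly (hden' k)
      (hx.1 k.succ) (hx.1 k.castSucc).1 (hx.2.1 k)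
  rw [Finset.sum_congr rfl h, SchurChains.sum_chains_eq_mul_schurPolynomial β z hlam,
    one_div, inv_mul_cancel_left₀ hP]
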